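/- Let $s\ge 1$ be an integer and let $q$ be a prime power. There is an integer $L$, depending only on $s$ and $q$, such that for every field $\mathbb F_q$ of order $q$ there is an $\boldsymbol\alpha=(1,\alpha_2,\dots,\alpha_s)\in\mathbb F_q[[x]]^s$, all of whose coordinates are invertible modulo $x^m$ for every $m\ge1$ (that is, $\boldsymbol\alpha\in\widetilde Y^s$), such that every hyperplane sequence associated with $\boldsymbol\alpha$ is a digital $(\mathbf T,s)$-sequence over $\mathbb F_q$ for some $\mathbf T:\mathbb N_0\to\mathbb N_0$ with $$\mathbf T(m)\le s\log_q m+2\log_q\log m+L\qquad\text{for all } m\ge 2,$$ where $\log$ is the natural logarithm. Hyperplane sequences associated with $\boldsymbol\alpha$ exist for every choice of the bases below, and their points lie in $[0,1)^s$ if all columns of the generating matrices have only finitely many nonzero entries. Here the terms mean the following. *Hyperplane sequences.* For each $1\le i\le s$ and each $m$ let $(\mathfrak b_{m,i,1},\dots,\mathfrak b_{m,i,m})$ be an ordered basis of $R_m=\mathbb F_q[x]/(x^m)$ over $\mathbb F_q$ such that, in coordinates with respect to $1,x,x^2,\dots$, $\mathfrak b_{m+1,i,j}=(\mathfrak b_{m,i,j},0)$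 for $1\le j\le m$. Let $\mathcal N_m\subseteq\mathbb F_q^{sm}$ be the set of the concatenated coordinate vectors, with respect to these bases, of all $(k_1,\dots,k_s)\in R_m^s$ with $\sum_{i=1}^s\alpha_ik_i\equiv0\pmod{x^m}$. A hyperplane sequence associated with $\boldsymbol\alpha$ is the digital sequence generated by $\mathbb N\times\mathbb N$ matrices $C_1,\dots,C_s$ over $\mathbb F_q$ such that, for every $m\ge1$, the row space of $(C_1^{(m)\top}\cdots C_s^{(m)\top})\in\mathbb F_q^{m\times sm}$ is the orthogonal complement $\mathcal N_m^\perp$, where $C_i^{(m)}$ is the left upper $m\times m$ submatrix of $C_i$. *Digital sequences.* Let $\varphi:\{0,\dots,q-1\}\to\mathbb F_q$ be any bijection with $\varphi(0)=0$. For $k=\kappa_0+\kappa_1q+\cdots$ with digits $\kappa_c\in\{0,\dots,q-1\}$ put $(y_{i,1}(k),y_{i,2}(k),\dots)^\top=C_i(\varphi(\kappa_0),\varphi(\kappa_1),\dots)^\top$. The $i$-th coordinate of the $k$-th point is $x_{k,i}=\sum_{j\ge1}\varphi^{-1}(y_{i,j}(k))q^{-j}\in[0,1]$, and $[x_{k,i}]_{q,m}$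 denotes the sum of the first $m$ terms of this series. The sequence is a digital $(\mathbf T,s)$-sequence over $\mathbb F_q$ if $\mathbf T(m)\le m$ for all $m\ge0$ and, for all $m,k\ge0$, the points $[\boldsymbol x_n]_{q,m}$, $kq^m\le n<(k+1)q^m$, form a $(\mathbf T(m),m,s)$-net in base $q$; that is, every interval $\prod_{i=1}^s[a_iq^{-d_i},(a_i+1)q^{-d_i})$ with integers $d_i\ge0$, $0\le a_i<q^{d_i}$ and volume $q^{\mathbf T(m)-m}$ contains exactly $q^{\mathbf T(m)}$ of them. -/

import Mathlib

open Polynomial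

noncomputable section

namespace HyperplaneSeq

/-- A family `P` of `b ^ m` points forms a `(t, m, s)`-net in base `b`: every elementary interval
`∏ [a i / b ^ d i, (a i + 1) / b ^ d i)` of volume `b ^ (t - m)`, that is with
`∑ i, d i = m - t`, contains exactly `b ^ t` of the points (counted with multiplicity). -/
structure IsNet (b t m : ℕ) {s : ℕ} (P : Fin (b ^ m) → Fin s → ℝ) : Prop where
  le : t ≤ m
  mem_cube : ∀ n i, P n i ∈ Set.Ico (0 : ℝ) 1
  count : ∀ d a : Fin s → ℕ, (∀ i, a i < b ^ d i) → ∑ i, d i + t = m →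
    {n : Fin (b ^ m) | ∀ i, P n i ∈
      Set.Ico ((a i : ℝ) / (b : ℝ) ^ d i) (((a i : ℝ) + 1) / (b : ℝ) ^ d i)}.ncard = b ^ t

/-- The truncation `∑_{j < m} d_j b^{-(j+1)}` of the base `b` expansion with digits `d`. -/
def trunc {b : ℕ} (m : ℕ) (d : ℕ → Fin b) : ℝ :=
  ∑ j ∈ Finset.range m, ((d j : ℕ) : ℝ) / (b : ℝ) ^ (j + 1)

/-- The points `x 0, x 1, …`, given together with base `b` expansions of their coordinates
(`dig k i j` is the coefficient of `b ^ (-(j + 1))` in the `i`-th coordinate of `x k`),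
form a `(T, s)`-sequence in base `b`. Truncation is always with respect to the given expansion,
which may end in digits `b - 1` only, so the points themselves lie in the closed unit cube. -/
structure IsTSSequence (b : ℕ) {s : ℕ} (T : ℕ → ℕ) (x : ℕ → Fin s → ℝ)
    (dig : ℕ → Fin s → ℕ → Fin b) : Prop where
  mem_cube : ∀ k i, x k i ∈ Set.Icc (0 : ℝ) 1
  expansion : ∀ k i, HasSum (fun j => ((dig k i j : ℕ) : ℝ) / (b : ℝ) ^ (j + 1)) (x k i)
  le : ∀ m, T m ≤ m
  net : ∀ m k : ℕ, IsNet b (T m) m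
    (fun (n : Fin (b ^ m)) (i : Fin s) => trunc m (dig (k * b ^ m + n) i))

variable {F : Type*} [Field F] {s q : ℕ}

/-- The `c`-th digit of `k` in base `q`; the bijection `φ` only serves to see that `q` is
positive. -/
def natDigit (φ : Fin q ≃ F) (k c : ℕ) : Fin q :=
  ⟨k / q ^ c % q, Nat.mod_lt _ (Fin.pos (φ.symm 0))⟩

/-- The digit `φ⁻¹ (y_{i,j}(k))`, where `y_i(k)` is the product of the infinite matrix `C i` with
the vector of the images under `φ` of the base `q` digits of `k`. Rows and columns are numbered
from `0`; as `φ` maps `0` to `0`, the digits beyond the length of `k` do not contribute. -/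
def digitalDigit (φ : Fin q ≃ F) (C : Fin s → Matrix ℕ ℕ F) (k : ℕ) (i : Fin s) (j : ℕ) : Fin q :=
  φ.symm (∑ c ∈ Finset.range (Nat.digits q k).length, C i j c * φ (natDigit φ k c))

/-- The points of the digital sequence generated by `C`. -/
def digitalPoint (φ : Fin q ≃ F) (C : Fin s → Matrix ℕ ℕ F) (k : ℕ) (i : Fin s) : ℝ :=
  ∑' j, ((digitalDigit φ C k i j : ℕ) : ℝ) / (q : ℝ) ^ (j + 1)

/-- The matrices `C` generate a digital `(T, s)`-sequence over the field `F` of order `q`. -/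
def IsDigitalTSSequence (φ : Fin q ≃ F) (C : Fin s → Matrix ℕ ℕ F) (T : ℕ → ℕ) : Prop :=
  IsTSSequence q T (digitalPoint φ C) (digitalDigit φ C)

/-- The overall generating matrix `(C_1^(m)ᵀ | … | C_s^(m)ᵀ)`, where `C_i^(m)` is the left upper
`m × m` submatrix of `C i`. -/
def overallMatrix (C : Fin s → Matrix ℕ ℕ F) (m : ℕ) : Matrix (Fin m) (Fin s × Fin m) F :=
  fun r p => C p.1 p.2 r

/-- The row space of a matrix. -/
def rowSpace {m n : Type*} (A : Matrix m n F) : Submodule F (n → F) :=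
  Submodule.span F (Set.range fun r => A r)

/-- The orthogonal complement for the standard inner product. -/
def dualSpace {n : Type*} [Fintype n] (N : Submodule F (n → F)) : Submodule F (n → F) where
  carrier := {A | ∀ B ∈ N, B ⬝ᵥ A = 0}
  add_mem' := fun ha hb B hB => by rw [dotProduct_add, ha B hB, hb B hB, add_zero]
  zero_mem' := fun B _ => dotProduct_zero B
  smul_mem' := fun c A hA B hB => by rw [dotProduct_smul, hA B hB, smul_zero]

/-- The residue class ring `F[x] / (x ^ m)`. -/
abbrev R (F : Type*) [Field F] (m : ℕ) : Type _ := AdjoinRoot (X ^ m : F[X])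

/-- The representative of degree less than `m` of a residue class modulo `x ^ m`. -/
def rep (m : ℕ) (k : R F m) : F[X] := AdjoinRoot.modByMonicHom (monic_X_pow m) k

/-- For every `i` and `m` an ordered basis of `F[x] / (x ^ m)`, such that in canonical coordinates
the `j`-th element of the `(m+1)`-st basis is the `j`-th element of the `m`-th basis followed by a
zero, for each of the first `m` elements. -/
structure BasisSystem (F : Type*) [Field F] (s : ℕ) where
  basis : ∀ (m : ℕ) (_ : Fin s), Module.Basis (Fin m) F (R F m)
  compat : ∀ (m : ℕ) (i : Fin s) (j : Fin m),
    rep (m + 1) (basis (m + 1) i j.castSucc) = rep m (basis m i j)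

/-- The set `Y` of power series whose reductions modulo every `x ^ m` are invertible. -/
def Y (F : Type*) [Field F] : Set (PowerSeries F) :=
  {α | ∀ m : ℕ, 1 ≤ m → IsCoprime (PowerSeries.trunc m α) (X ^ m : F[X])}

/-- The set of all `α ∈ Y ^ s` whose first coordinate is `1`. -/
def YTilde (F : Type*) [Field F] (s : ℕ) : Set (Fin s → PowerSeries F) :=
  {α | (∀ i, α i ∈ Y F) ∧ ∀ i : Fin s, (i : ℕ) = 0 → α i = 1}

/-- The reduction of a power series modulo `x ^ m`. -/
def red (m : ℕ) (α : PowerSeries F) : R F m := AdjoinRoot.mk (X ^ m) (PowerSeries.trunc m α)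

/-- The space of all `k ∈ (F[x] / (x ^ m)) ^ s` with `α · k ≡ 0 (mod x ^ m)`. -/
def hyperplane (α : Fin s → PowerSeries F) (m : ℕ) : Submodule F (Fin s → R F m) where
  carrier := {k | ∑ i, red m (α i) * k i = 0}
  add_mem' := fun {a b} ha hb => by
    change _ = _ at ha hb ⊢
    simp [mul_add, Finset.sum_add_distrib, ha, hb]
  zero_mem' := by simp
  smul_mem' := fun c k hk => by
    change _ = _ at hk ⊢
    simp only [Pi.smul_apply, mul_smul_comm, ← Finset.smul_sum, hk, smul_zero]

/-- The map sending `k ∈ (F[x] / (x ^ m)) ^ s` to the concatenation of the coordinate vectors of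
its entries. -/
def theta (B : BasisSystem F s) (m : ℕ) : (Fin s → R F m) →ₗ[F] (Fin s × Fin m → F) where
  toFun k p := (B.basis m p.1).repr (k p.1) p.2
  map_add' k l := by ext p; simp
  map_smul' c k := by ext p; simp

/-- The dual space chain attached to `α`. -/
def chain (B : BasisSystem F s) (α : Fin s → PowerSeries F) (m : ℕ) :
    Submodule F (Fin s × Fin m → F) :=
  (hyperplane α m).map (theta B m)

/-- The matrices `C` generate a hyperplane sequence associated with `α` (with respect to the bases
`B`): for every `m ≥ 1` the row space of the `m`-th overall generating matrix is the dual of the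
`m`-th member of the chain attached to `α`. -/
def GeneratesHyperplaneSequence (B : BasisSystem F s) (α : Fin s → PowerSeries F)
    (C : Fin s → Matrix ℕ ℕ F) : Prop :=
  ∀ m : ℕ, 1 ≤ m → rowSpace (overallMatrix C m) = dualSpace (chain B α m)

end HyperplaneSeq

end

/-! ### The quality function and convergence of the weights. -/

namespace HyperplaneSeq

/-! By duality, the net property for `m` reduces to this: no nonzero `k` with `deg k_i < d_i`, `∑
d_i = m - T(m)`, satisfies `∑ α_i k_i ≡ 0` modulo `x ^ m`. The choice of bases is irrelevant, since
compatibility forces the `j`-th basis element (from `0`) to have degree at most `j`. If `T` is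
monotone, dividing by `x` leaves only primitive `k` (some `k_i(0) ≠ 0`) to be excluded, for every
modulus `x ^ (n + 1)` (`eq_zero_of_X_pow_dvd_linForm`).

A good `α` is found by counting. Put `α_i = 1 + x β_i` for all but the first coordinate, with `β_i`
random. A primitive solution has a unit among the `k_j` with random `α_j`, so a fixed `k` is a
solution with probability at most `q ^ (-n)`. With `w = n + 1 - T(n + 1)` there are at most `(w + 1)
^ (s - 1) q ^ w` candidates `k`. If `q ^ T(m)` is at least a large multiple of `m ^ s log(m) ^ 2`
whenever `T(m) < m`, the failure probabilities are dominated by a small multiple of `∑ 1 / (n log(n)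
^ 2)` and sum to less than `1`. Hence finitely many conditions can always be met together, and
compactness gives all of them (`exists_forall_noPrimitiveSolution`). -/

theorem exists_sum_inv_mul_log_sq_le : ∃ K : ℝ, 0 < K ∧ ∀ M : ℕ,
    ∑ n ∈ Finset.range M, 1 / (((n : ℝ) + 2) * Real.log ((n : ℝ) + 2) ^ 2) ≤ K := by
  have hpos : ∀ n : ℕ, 0 < Real.log ((n : ℝ) + 2) := fun n =>
    Real.log_pos (by have : (0 : ℝ) ≤ n := n.cast_nonneg
                     linarith)
  -- Telescoping: `log n - log (n - 1) ≥ 1 / n` gives `1 / (n log(n) ^ 2) ≤ 1 / log (n - 1) - 1 /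
  -- log n`.
  have key : ∀ M : ℕ,
      ∑ n ∈ Finset.range (M + 1), 1 / (((n : ℝ) + 2) * Real.log ((n : ℝ) + 2) ^ 2)
        ≤ 1 / (2 * Real.log 2 ^ 2) + 1 / Real.log 2 - 1 / Real.log ((M : ℝ) + 2) := by
    intro M
    induction M with
    | zero => simp
    | succ M ih =>
      rw [Finset.sum_range_succ]
      have h1 := hpos M
      have h2 := hpos (M + 1)
      push_cast at h2 ⊢
      have hM : (0 : ℝ) ≤ M := M.cast_nonneg
      have e : (M : ℝ) + 1 + 2 = M + 3 := by ring
      rw [e] at h2 ⊢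
      have hstep : 1 / ((M : ℝ) + 3) ≤ Real.log (M + 3) - Real.log (M + 2) := by
        have := Real.log_le_sub_one_of_pos (x := ((M : ℝ) + 2) / (M + 3)) (by positivity)
        rw [Real.log_div (by positivity) (by positivity)] at this
        have e2 : ((M : ℝ) + 2) / (M + 3) - 1 = - (1 / (M + 3)) := by
          field_simp
          ring
        linarith
      have hmono : Real.log ((M : ℝ) + 2) ≤ Real.log (M + 3) :=
        Real.log_le_log (by positivity) (by linarith)
      have : 1 / (((M : ℝ) + 3) * Real.log (M + 3) ^ 2)
          ≤ 1 / Real.log (M + 2) - 1 / Real.log (M + 3) := by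
        rw [div_sub_div _ _ h1.ne' h2.ne', one_mul, mul_one, ← div_div]
        calc 1 / ((M : ℝ) + 3) / Real.log (M + 3) ^ 2
            ≤ (Real.log (M + 3) - Real.log (M + 2)) / Real.log (M + 3) ^ 2 := by gcongr
          _ ≤ (Real.log (M + 3) - Real.log (M + 2)) / (Real.log (M + 2) * Real.log (M + 3)) := by
            apply div_le_div_of_nonneg_left (by linarith) (by positivity)
            rw [sq]
            gcongr
      linarith
  have hl : 0 < Real.log 2 := Real.log_pos (by norm_num)
  refine ⟨1 / (2 * Real.log 2 ^ 2) + 1 / Real.log 2, by positivity, fun M => ?_⟩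
  refine (Finset.sum_le_sum_of_subset_of_nonneg (Finset.range_mono (Nat.le_succ M))
    fun n _ _ => ?_).trans ((key M).trans ?_)
  · have := hpos n
    positivity
  · have := hpos M
    have : 0 < 1 / Real.log ((M : ℝ) + 2) := by positivity
    linarith

/-- The quality function `min m ⌈log_q (C (m + 1) ^ s log (m + 1) ^ 2)⌉`. -/
noncomputable def quality (s q : ℕ) (A : ℝ) (m : ℕ) : ℕ :=
  min m (Nat.clog q ⌈A * ((m : ℝ) + 1) ^ s * Real.log ((m : ℝ) + 1) ^ 2⌉₊)

theorem quality_le (s q : ℕ) (A : ℝ) (m : ℕ) : quality s q A m ≤ m := min_le_left _ _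

theorem quality_mono (s q : ℕ) {A : ℝ} (hA : 0 ≤ A) : Monotone (quality s q A) := by
  intro m n h
  have hm : (0 : ℝ) ≤ m := m.cast_nonneg
  have hmn : (m : ℝ) ≤ n := by exact_mod_cast h
  have h0 : 0 ≤ Real.log ((m : ℝ) + 1) := Real.log_nonneg (by linarith)
  have h1 : Real.log ((m : ℝ) + 1) ≤ Real.log ((n : ℝ) + 1) :=
    Real.log_le_log (by positivity) (by linarith)
  exact min_le_min h (Nat.clog_mono_right _ (Nat.ceil_mono (by gcongr)))

theorem exists_quality_le {s q : ℕ} (hq : 2 ≤ q) {A : ℝ} (hA : 0 < A) : ∃ L : ℤ, ∀ m : ℕ, 2 ≤ m →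
    (quality s q A m : ℝ) ≤ s * Real.logb q m + 2 * Real.logb q (Real.log m) + L := by
  have hq1 : (1 : ℝ) < q := by exact_mod_cast hq
  have hl2 : 0 < Real.log 2 := Real.log_pos (by norm_num)
  -- a constant `D` with `A (m+1)^s log(m+1)^2 + 1 ≤ D m^s log(m)^2`
  set D : ℝ := A * 2 ^ s * 4 + 1 / Real.log 2 ^ 2 with hD
  have hDpos : 0 < D := by positivity
  -- The summand `1` pays for the rounding in `Nat.clog`; the rounding in the ceiling is already
  -- absorbed by `D`.
  obtain ⟨L, hL⟩ := exists_int_gt (1 + Real.logb q D)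
  refine ⟨L, fun m hm => ?_⟩
  have hm2 : (2 : ℝ) ≤ m := by exact_mod_cast hm
  have hlm2 : Real.log 2 ≤ Real.log m := Real.log_le_log (by norm_num) hm2
  have hlm : 0 < Real.log m := by linarith
  have hlm1 : Real.log ((m : ℝ) + 1) ≤ 2 * Real.log m := by
    rw [← Real.log_rpow (by linarith)]
    refine Real.log_le_log (by linarith) ?_
    norm_num
    nlinarith
  have hlm0 : 0 < Real.log ((m : ℝ) + 1) := Real.log_pos (by linarith)
  set x : ℝ := A * ((m : ℝ) + 1) ^ s * Real.log ((m : ℝ) + 1) ^ 2 with hx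
  have hxpos : 0 < x := by positivity
  have hxD : x + 1 ≤ D * ((m : ℝ) ^ s * Real.log m ^ 2) := by
    have h1 : x ≤ A * (2 * m) ^ s * (2 * Real.log m) ^ 2 := by
      rw [hx]
      gcongr
      linarith
    have h2 : 1 ≤ 1 / Real.log 2 ^ 2 * ((m : ℝ) ^ s * Real.log m ^ 2) := by
      rw [one_div, ← div_eq_inv_mul, le_div_iff₀ (by positivity), one_mul]
      calc Real.log 2 ^ 2 ≤ Real.log m ^ 2 := by gcongr
        _ ≤ (m : ℝ) ^ s * Real.log m ^ 2 :=
          le_mul_of_one_le_left (by positivity) (one_le_pow₀ (by linarith))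
    calc x + 1 ≤ A * (2 * m) ^ s * (2 * Real.log m) ^ 2
          + 1 / Real.log 2 ^ 2 * ((m : ℝ) ^ s * Real.log m ^ 2) := add_le_add h1 h2
      _ = _ := by rw [hD, mul_pow, mul_pow]; ring
  set t := Nat.clog q ⌈x⌉₊ with ht
  have hqt : (t : ℝ) ≤ 1 + Real.logb q (D * ((m : ℝ) ^ s * Real.log m ^ 2)) := by
    rcases Nat.eq_zero_or_pos t with h0 | h0
    · rw [h0, Nat.cast_zero]
      have : 0 ≤ Real.logb q (D * ((m : ℝ) ^ s * Real.log m ^ 2)) :=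
        Real.logb_nonneg hq1 (by linarith)
      linarith
    · have h1 : q ^ (t - 1) < ⌈x⌉₊ := by
        by_contra hcon
        have := Nat.clog_le_of_le_pow (not_lt.1 hcon)
        omega
      have h2 : (q : ℝ) ^ (t - 1) < x + 1 := by
        calc (q : ℝ) ^ (t - 1) < (⌈x⌉₊ : ℝ) := by exact_mod_cast h1
          _ ≤ x + 1 := (Nat.ceil_lt_add_one hxpos.le).le
      have h3 : ((t - 1 : ℕ) : ℝ) ≤ Real.logb q (D * ((m : ℝ) ^ s * Real.log m ^ 2)) := by
        rw [Real.le_logb_iff_rpow_le hq1 (by positivity), Real.rpow_natCast]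
        linarith
      rw [Nat.cast_sub h0, Nat.cast_one] at h3
      linarith
  have hexp : Real.logb q (D * ((m : ℝ) ^ s * Real.log m ^ 2))
      = Real.logb q D + (s * Real.logb q m + 2 * Real.logb q (Real.log m)) := by
    rw [Real.logb_mul hDpos.ne' (by positivity), Real.logb_mul (by positivity) (by positivity),
      Real.logb_pow, Real.logb_pow]
    norm_num
  have hmin : (quality s q A m : ℝ) ≤ t := by exact_mod_cast min_le_right _ _
  linarith

/-- If `A` is large, the weights `(w + 1) ^ t q ^ w / q ^ n` with `w = n + 1 - T (n + 1)` have
partial sums below `1`. -/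
theorem exists_sum_weight_lt_one (t : ℕ) {q : ℕ} (hq : 2 ≤ q) : ∃ A : ℝ, 0 < A ∧ ∀ M : ℕ,
    ∑ n ∈ Finset.range M, (if n + 1 - quality (t + 1) q A (n + 1) = 0 then (0 : ℝ) else
      ((n + 1 - quality (t + 1) q A (n + 1) : ℕ) + 1 : ℝ) ^ t
        * (q : ℝ) ^ (n + 1 - quality (t + 1) q A (n + 1)) / (q : ℝ) ^ n) < 1 := by
  obtain ⟨K, hK, hsum⟩ := exists_sum_inv_mul_log_sq_le
  have hq0 : (0 : ℝ) < q := by positivity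
  -- The sum will be at most `q K / A`, which is `1 / 2` for this `A`.
  refine ⟨2 * q * K, by positivity, fun M => ?_⟩
  set A : ℝ := 2 * q * K with hA
  have hApos : 0 < A := by positivity
  have hterm : ∀ n : ℕ, (if n + 1 - quality (t + 1) q A (n + 1) = 0 then (0 : ℝ) else
      ((n + 1 - quality (t + 1) q A (n + 1) : ℕ) + 1 : ℝ) ^ t
        * (q : ℝ) ^ (n + 1 - quality (t + 1) q A (n + 1)) / (q : ℝ) ^ n)
      ≤ q / A * (1 / (((n : ℝ) + 2) * Real.log ((n : ℝ) + 2) ^ 2)) := by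
    intro n
    have hlog : 0 < Real.log ((n : ℝ) + 2) := Real.log_pos (by
      have : (0 : ℝ) ≤ n := n.cast_nonneg
      linarith)
    split_ifs with h
    · positivity
    · have hle := quality_le (t + 1) q A (n + 1)
      set T := quality (t + 1) q A (n + 1) with hT
      -- A nonzero weight means `T < n + 1`, so the minimum in `quality` is attained by the
      -- logarithm.
      have hTeq : T = Nat.clog q
          ⌈A * (((n + 1 : ℕ) : ℝ) + 1) ^ (t + 1) * Real.log (((n + 1 : ℕ) : ℝ) + 1) ^ 2⌉₊ := by
        rw [hT, quality, min_eq_right_iff]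
        by_contra hcon
        have : T = n + 1 := by
          rw [hT, quality]
          exact min_eq_left (not_le.1 hcon).le
        omega
      have e : ((n + 1 : ℕ) : ℝ) + 1 = n + 2 := by push_cast; ring
      rw [e] at hTeq
      have hqT : A * ((n : ℝ) + 2) ^ (t + 1) * Real.log ((n : ℝ) + 2) ^ 2 ≤ (q : ℝ) ^ T := by
        refine (Nat.le_ceil _).trans ?_
        rw [hTeq]
        exact_mod_cast Nat.le_pow_clog (by omega) _
      have hw : (((n + 1 - T : ℕ) : ℝ) + 1) ≤ n + 2 := by
        rw [← e]
        gcongr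
        omega
      have hqw : (q : ℝ) ^ (n + 1 - T) / (q : ℝ) ^ n = q / (q : ℝ) ^ T := by
        rw [div_eq_div_iff (by positivity) (by positivity), ← pow_add, ← pow_succ']
        congr 1
        omega
      rw [mul_div_assoc, hqw]
      calc (((n + 1 - T : ℕ) : ℝ) + 1) ^ t * (q / (q : ℝ) ^ T)
          ≤ ((n : ℝ) + 2) ^ t
            * (q / (A * ((n : ℝ) + 2) ^ (t + 1) * Real.log ((n : ℝ) + 2) ^ 2)) := by
            gcongr
        _ = _ := by
            rw [pow_succ]
            field_simp
  calc _ ≤ ∑ n ∈ Finset.range M,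
        q / A * (1 / (((n : ℝ) + 2) * Real.log ((n : ℝ) + 2) ^ 2)) :=
        Finset.sum_le_sum fun n _ => hterm n
    _ ≤ q / A * K := by
        rw [← Finset.mul_sum]
        gcongr
        exact hsum M
    _ < 1 := by
        rw [hA]
        field_simp
        norm_num

end HyperplaneSeq

/-! ### Counting, compactness and descent for solutions of the congruence. -/

namespace HyperplaneSeq

variable {F : Type*} [Field F]

/-- The vector `(1, 1 + x β_1, 1 + x β_2, …)` of power series. -/
noncomputable def unitSeries {s : ℕ} (β : Fin s → ℕ → F) (i : Fin s) : PowerSeries F :=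
  if (i : ℕ) = 0 then 1 else 1 + PowerSeries.X * PowerSeries.mk (β i)

theorem constantCoeff_unitSeries {s : ℕ} (β : Fin s → ℕ → F) (i : Fin s) :
    PowerSeries.constantCoeff (unitSeries β i) = 1 := by
  unfold unitSeries
  split_ifs <;> simp

theorem unitSeries_mem_YTilde {s : ℕ} (β : Fin s → ℕ → F) : unitSeries β ∈ YTilde F s := by
  refine ⟨fun i m hm => ?_, fun i hi => by simp [unitSeries, hi]⟩
  refine IsCoprime.pow_right ?_
  have h0 : (PowerSeries.trunc m (unitSeries β i)).coeff 0 = 1 := by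
    rw [PowerSeries.coeff_trunc, if_pos (by omega), PowerSeries.coeff_zero_eq_constantCoeff_apply,
      constantCoeff_unitSeries]
  obtain ⟨g, hg⟩ := (X_dvd_iff (f := PowerSeries.trunc m (unitSeries β i) - 1)).2 (by simp [h0])
  exact ⟨1, -g, by linear_combination hg⟩

/-- The linear form `∑ α_i k_i` of a vector of polynomials. -/
noncomputable def linForm {s : ℕ} (α : Fin s → PowerSeries F) (k : Fin s → F[X]) : PowerSeries F :=
  ∑ i, α i * (k i : PowerSeries F)

/-- The two linear forms differ by `x (β_j - β'_j) k_j`, and `k_j` is a unit among power series. -/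
theorem eq_of_X_pow_dvd_linForm {s n : ℕ} {k : Fin s → F[X]} {j : Fin s} (hj : (j : ℕ) ≠ 0)
    (hk : (k j).coeff 0 ≠ 0) {β β' : Fin s → ℕ → F} (hββ' : ∀ i, i ≠ j → β i = β' i)
    (h : (PowerSeries.X : PowerSeries F) ^ (n + 1) ∣ linForm (unitSeries β) k)
    (h' : (PowerSeries.X : PowerSeries F) ^ (n + 1) ∣ linForm (unitSeries β') k)
    {l : ℕ} (hl : l < n) : β j l = β' j l := by
  have hd := dvd_sub h h'
  have e : linForm (unitSeries β) k - linForm (unitSeries β') k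
      = PowerSeries.X * ((PowerSeries.mk (β j) - PowerSeries.mk (β' j)) * (k j : PowerSeries F)) := by
    unfold linForm
    rw [← Finset.sum_sub_distrib, Finset.sum_eq_single j]
    · simp only [unitSeries, hj, if_false]
      ring
    · intro i _ hij
      simp [unitSeries, hββ' i hij]
    · simp
  rw [e, pow_succ', mul_dvd_mul_iff_left PowerSeries.X_ne_zero] at hd
  have hu : IsUnit (k j : PowerSeries F) := by
    rw [PowerSeries.isUnit_iff_constantCoeff, ← PowerSeries.coeff_zero_eq_constantCoeff_apply,
      Polynomial.coeff_coe]
    exact hk.isUnit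
  rw [hu.dvd_mul_right, PowerSeries.X_pow_dvd_iff] at hd
  simpa [sub_eq_zero] using hd l hl

/-- The factor `x` in `unitSeries` moves the entries of `β` from index `n` on beyond the modulus. -/
theorem X_pow_dvd_linForm_congr {s n : ℕ} {k : Fin s → F[X]} {β β' : Fin s → ℕ → F}
    (hββ' : ∀ i, ∀ l < n, β i l = β' i l) :
    (PowerSeries.X : PowerSeries F) ^ (n + 1) ∣ linForm (unitSeries β) k ↔
      (PowerSeries.X : PowerSeries F) ^ (n + 1) ∣ linForm (unitSeries β') k := by
  refine dvd_iff_dvd_of_dvd_sub ?_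
  unfold linForm
  rw [← Finset.sum_sub_distrib]
  refine Finset.dvd_sum fun i _ => ?_
  rw [← sub_mul]
  refine Dvd.dvd.mul_right ?_ _
  unfold unitSeries
  split_ifs
  · simp
  · rw [add_sub_add_left_eq_sub, ← mul_sub, pow_succ']
    refine mul_dvd_mul_left _ ?_
    rw [PowerSeries.X_pow_dvd_iff]
    intro l hl
    simp [hββ' i l hl]

/-- Extension of a finite array by zeros. -/
def extendZero {s M : ℕ} (β : Fin s → Fin M → F) (i : Fin s) (l : ℕ) : F :=
  if h : l < M then β i ⟨l, h⟩ else 0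

-- Adding an arbitrary vector to the first `n` entries of row `j` of a bad array is injective on
-- pairs: the other rows of a bad array determine these entries.
open Classical in
theorem card_filter_X_pow_dvd_linForm_mul_le [Fintype F] {s n M : ℕ} (hn : n ≤ M)
    {k : Fin s → F[X]} {j : Fin s} (hj : (j : ℕ) ≠ 0) (hk : (k j).coeff 0 ≠ 0) :
    (Finset.univ.filter fun β : Fin s → Fin M → F =>
        (PowerSeries.X : PowerSeries F) ^ (n + 1) ∣ linForm (unitSeries (extendZero β)) k).card
      * Fintype.card F ^ n ≤ Fintype.card (Fin s → Fin M → F) := by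
  set bad := Finset.univ.filter fun β : Fin s → Fin M → F =>
        (PowerSeries.X : PowerSeries F) ^ (n + 1) ∣ linForm (unitSeries (extendZero β)) k with hbad
  have e : Fintype.card F ^ n = (Finset.univ : Finset (Fin n → F)).card := by simp
  rw [e, ← Finset.card_product, ← Finset.card_univ]
  refine Finset.card_le_card_of_injOn
    (fun p => Function.update p.1 j fun l => if h : (l : ℕ) < n then p.1 j l + p.2 ⟨l, h⟩
      else p.1 j l) (fun _ _ => Finset.mem_coe.2 (Finset.mem_univ _)) ?_
  rintro ⟨β, γ⟩ hb ⟨β', γ'⟩ hb' heq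
  simp only [Finset.coe_product, Set.mem_prod, Finset.mem_coe, hbad, Finset.mem_filter,
    Finset.mem_univ, true_and, and_true] at hb hb'
  have hne : ∀ i, i ≠ j → β i = β' i := fun i hi => by
    simpa [Function.update_of_ne hi] using congrFun heq i
  have hjj : ∀ l : Fin M, (if h : (l : ℕ) < n then β j l + γ ⟨l, h⟩ else β j l)
      = (if h : (l : ℕ) < n then β' j l + γ' ⟨l, h⟩ else β' j l) := fun l => by
    simpa using congrFun (congrFun heq j) l
  have hlow : ∀ l : Fin M, (l : ℕ) < n → β j l = β' j l := fun l hl => by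
    have := eq_of_X_pow_dvd_linForm hj hk (β := extendZero β) (β' := extendZero β')
      (fun i hi => by funext l; simp [extendZero, hne i hi]) hb hb' hl
    simpa [extendZero] using this
  have hββ' : β = β' := by
    funext i l
    by_cases hi : i = j
    · subst hi
      by_cases hl : (l : ℕ) < n
      · exact hlow l hl
      · simpa [hl] using hjj l
    · rw [hne i hi]
  subst hββ'
  simp only [Prod.mk.injEq, true_and]
  funext l
  have := hjj ⟨l, l.2.trans_le hn⟩
  simpa using this

/-- The entries after the first determine the tuple and lie in `{0, …, w}`. -/
theorem card_piAntidiag_fin_succ_le (t w : ℕ) :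
    (Finset.piAntidiag (Finset.univ : Finset (Fin (t + 1))) w).card ≤ (w + 1) ^ t := by
  have e : (w + 1) ^ t = (Fintype.piFinset fun _ : Fin t => Finset.range (w + 1)).card := by simp
  rw [e]
  refine Finset.card_le_card_of_injOn Fin.tail (fun d hd => ?_) fun d hd d' hd' h => ?_
  · simp only [Finset.mem_coe, Finset.mem_piAntidiag] at hd
    simp only [Finset.mem_coe, Fintype.mem_piFinset, Finset.mem_range]
    intro i
    have := Finset.single_le_sum (f := d) (fun _ _ => Nat.zero_le _) (Finset.mem_univ i.succ)
    exact Nat.lt_succ_of_le (this.trans_eq hd.1)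
  · simp only [Finset.mem_coe, Finset.mem_piAntidiag] at hd hd'
    have h1 := hd.1
    have h2 := hd'.1
    rw [Fin.sum_univ_succ] at h1 h2
    have h3 : ∀ i : Fin t, d i.succ = d' i.succ := fun i => congrFun h i
    simp only [h3] at h1
    funext i
    refine Fin.cases ?_ h3 i
    omega

/-- No vector `k` of polynomials that is not divisible by `x` and satisfies `deg k_i < d_i`, where
`∑ d_i = w`, satisfies `∑ α_i k_i ≡ 0` modulo `x ^ (n + 1)`. -/
def NoPrimitiveSolution {s : ℕ} (α : Fin s → PowerSeries F) (w n : ℕ) : Prop :=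
  ∀ d : Fin s → ℕ, ∑ i, d i = w → ∀ k : Fin s → F[X], (∀ i, (k i).degree < d i) →
    (∃ i, (k i).coeff 0 ≠ 0) → ¬ (PowerSeries.X : PowerSeries F) ^ (n + 1) ∣ linForm α k

/-- All `α_i` have constant term `1`, so a single nonzero `k_i(0)` could not cancel. Thus a
coordinate with random `α_j` is available for the count. -/
theorem exists_coeff_zero_ne_zero_of_X_pow_dvd {s n : ℕ} {β : Fin s → ℕ → F} {k : Fin s → F[X]}
    (h : (PowerSeries.X : PowerSeries F) ^ (n + 1) ∣ linForm (unitSeries β) k)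
    (hk : ∃ i, (k i).coeff 0 ≠ 0) : ∃ j : Fin s, (j : ℕ) ≠ 0 ∧ (k j).coeff 0 ≠ 0 := by
  by_contra! hcon
  obtain ⟨i, hi⟩ := hk
  have hi0 : (i : ℕ) = 0 := by
    by_contra h0
    exact hi (hcon i h0)
  have := PowerSeries.X_dvd_iff.1 ((dvd_pow_self _ n.succ_ne_zero).trans h)
  rw [linForm, map_sum, Finset.sum_eq_single i] at this
  · rw [map_mul, constantCoeff_unitSeries, one_mul,
      ← PowerSeries.coeff_zero_eq_constantCoeff_apply, Polynomial.coeff_coe] at this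
    exact hi this
  · intro j _ hji
    rw [map_mul, ← PowerSeries.coeff_zero_eq_constantCoeff_apply (k j : PowerSeries F),
      Polynomial.coeff_coe, hcon j fun h0 => hji (Fin.ext (by omega)), mul_zero]
  · simp

-- Union bound over the degree bounds `d` and the `q ^ w` vectors `k` obeying each of them. For `w =
-- 0` only `k = 0` is allowed, which is not primitive.
open Classical in
theorem card_filter_not_noPrimitiveSolution_mul_le [Fintype F] {t n M : ℕ} (hn : n ≤ M) (w : ℕ) :
    (Finset.univ.filter fun β : Fin (t + 1) → Fin M → F =>
        ¬ NoPrimitiveSolution (unitSeries (extendZero β)) w n).card * Fintype.card F ^ n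
      ≤ (if w = 0 then 0 else (w + 1) ^ t * Fintype.card F ^ w)
        * Fintype.card (Fin (t + 1) → Fin M → F) := by
  set V := Fin (t + 1) → Fin M → F
  split_ifs with hw
  · subst hw
    rw [zero_mul, Nat.le_zero, mul_eq_zero, Finset.card_eq_zero]
    left
    rw [Finset.filter_eq_empty_iff]
    intro β _ hβ
    refine hβ fun d hd k hk ⟨i, hi⟩ => ?_
    have h0 : d i = 0 := (Finset.sum_eq_zero_iff.1 hd) i (Finset.mem_univ i)
    have := hk i
    rw [h0, Nat.cast_zero, Nat.WithBot.lt_zero_iff, degree_eq_bot] at this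
    exact absurd (by rw [this, coeff_zero]) hi
  · let poly : ∀ d : Fin (t + 1) → ℕ, (∀ i, Fin (d i) → F) → Fin (t + 1) → F[X] :=
      fun d u i => ((degreeLTEquiv F (d i)).symm (u i) : F[X])
    let bad : (Fin (t + 1) → F[X]) → Finset V := fun k =>
      if ∃ i, (k i).coeff 0 ≠ 0 then Finset.univ.filter fun β : V =>
        (PowerSeries.X : PowerSeries F) ^ (n + 1) ∣ linForm (unitSeries (extendZero β)) k else ∅
    have hbad : ∀ k, (bad k).card * Fintype.card F ^ n ≤ Fintype.card V := by
      intro k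
      rcases (bad k).eq_empty_or_nonempty with h | ⟨β, hβ⟩
      · simp [h]
      · have hk : ∃ i, (k i).coeff 0 ≠ 0 := by
          by_contra hcon
          simp [bad, hcon] at hβ
        simp only [bad, hk, if_true, Finset.mem_filter] at hβ ⊢
        obtain ⟨j, hj, hkj⟩ := exists_coeff_zero_ne_zero_of_X_pow_dvd hβ.2 hk
        exact card_filter_X_pow_dvd_linForm_mul_le hn hj hkj
    have hsub : (Finset.univ.filter fun β : V =>
        ¬ NoPrimitiveSolution (unitSeries (extendZero β)) w n) ⊆
        (Finset.piAntidiag Finset.univ w).biUnion fun d =>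
          Finset.univ.biUnion fun u : ∀ i, Fin (d i) → F => bad (poly d u) := by
      intro β hβ
      replace hβ := (Finset.mem_filter.1 hβ).2
      unfold NoPrimitiveSolution at hβ
      push Not at hβ
      obtain ⟨d, hd, k, hk, hprim, hdvd⟩ := hβ
      simp only [Finset.mem_biUnion, Finset.mem_univ, true_and]
      refine ⟨d, Finset.mem_piAntidiag.2 ⟨hd, fun i _ => Finset.mem_univ i⟩,
        fun i => degreeLTEquiv F (d i) ⟨k i, mem_degreeLT.2 (hk i)⟩, ?_⟩
      have e : poly d (fun i => degreeLTEquiv F (d i) ⟨k i, mem_degreeLT.2 (hk i)⟩) = k := by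
        funext i
        simp [poly]
      rw [e]
      simp only [bad, hprim, if_true, Finset.mem_filter, Finset.mem_univ, true_and]
      exact hdvd
    calc _ ≤ (∑ d ∈ Finset.piAntidiag Finset.univ w, ∑ u : ∀ i, Fin (d i) → F,
            (bad (poly d u)).card) * Fintype.card F ^ n := by
          refine Nat.mul_le_mul_right _ ((Finset.card_le_card hsub).trans ?_)
          exact Finset.card_biUnion_le.trans
            (Finset.sum_le_sum fun d _ => Finset.card_biUnion_le)
      _ = ∑ d ∈ Finset.piAntidiag Finset.univ w, ∑ u : ∀ i, Fin (d i) → F,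
            (bad (poly d u)).card * Fintype.card F ^ n := by
          simp only [Finset.sum_mul]
      _ ≤ ∑ d ∈ Finset.piAntidiag (Finset.univ : Finset (Fin (t + 1))) w,
            ∑ u : ∀ i, Fin (d i) → F, Fintype.card V :=
          Finset.sum_le_sum fun d _ => Finset.sum_le_sum fun u _ => hbad _
      _ = ∑ d ∈ Finset.piAntidiag (Finset.univ : Finset (Fin (t + 1))) w,
            Fintype.card F ^ w * Fintype.card V := by
          refine Finset.sum_congr rfl fun d hd => ?_
          have hd' := (Finset.mem_piAntidiag.1 hd).1
          rw [Finset.sum_const, Finset.card_univ, Fintype.card_pi, smul_eq_mul]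
          simp [Finset.prod_pow_eq_pow_sum, hd']
      _ ≤ _ := by
          rw [Finset.sum_const, smul_eq_mul, mul_assoc]
          exact Nat.mul_le_mul_right _ (card_piAntidiag_fin_succ_le t w)

/-- The sum over `n < M` of the proportions of vectors that admit a primitive solution being less
than `1`, some vector admits none. -/
theorem exists_forall_lt_noPrimitiveSolution [Fintype F] (t : ℕ) (w : ℕ → ℕ) (M : ℕ)
    (hsum : ∑ n ∈ Finset.range M, (if w n = 0 then (0 : ℝ) else
      ((w n : ℝ) + 1) ^ t * (Fintype.card F : ℝ) ^ w n / (Fintype.card F : ℝ) ^ n) < 1) :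
    ∃ β : Fin (t + 1) → ℕ → F, ∀ n < M, NoPrimitiveSolution (unitSeries β) (w n) n := by
  classical
  set V := Fin (t + 1) → Fin M → F with hV
  have hq : (0 : ℝ) < Fintype.card F := by exact_mod_cast Fintype.card_pos
  have hVpos : (0 : ℝ) < Fintype.card V := by exact_mod_cast Fintype.card_pos
  let bad : ℕ → Finset V := fun n => Finset.univ.filter fun β =>
    ¬ NoPrimitiveSolution (unitSeries (extendZero β)) (w n) n
  have hb : ∀ n ∈ Finset.range M, ((bad n).card : ℝ) ≤ (if w n = 0 then (0 : ℝ) else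
      ((w n : ℝ) + 1) ^ t * (Fintype.card F : ℝ) ^ w n / (Fintype.card F : ℝ) ^ n)
        * Fintype.card V := by
    intro n hn
    have h := card_filter_not_noPrimitiveSolution_mul_le (F := F) (t := t)
      (Finset.mem_range.1 hn).le (w n)
    have h' : ((bad n).card : ℝ) * (Fintype.card F : ℝ) ^ n ≤ (if w n = 0 then (0 : ℝ) else
        ((w n : ℝ) + 1) ^ t * (Fintype.card F : ℝ) ^ w n) * Fintype.card V := by
      have := (Nat.cast_le (α := ℝ)).2 h
      push_cast at this
      exact this
    rw [← le_div_iff₀ (by positivity)] at h'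
    refine h'.trans (le_of_eq ?_)
    split_ifs
    · simp
    · ring
  have hlt : ((Finset.range M).biUnion bad).card < Fintype.card V := by
    have h1 : (((Finset.range M).biUnion bad).card : ℝ) ≤ ∑ n ∈ Finset.range M, ((bad n).card : ℝ) := by
      exact_mod_cast Finset.card_biUnion_le
    have h2 := h1.trans (Finset.sum_le_sum hb)
    rw [← Finset.sum_mul] at h2
    have h3 := h2.trans_lt (mul_lt_of_lt_one_left hVpos hsum)
    exact_mod_cast h3
  obtain ⟨β, hβ⟩ : ∃ β, β ∉ (Finset.range M).biUnion bad := by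
    by_contra! hcon
    exact hlt.ne (Finset.card_eq_iff_eq_univ _ |>.2 (Finset.eq_univ_of_forall hcon))
  refine ⟨extendZero β, fun n hn => ?_⟩
  by_contra hcon
  refine hβ (Finset.mem_biUnion.2 ⟨n, Finset.mem_range.2 hn, ?_⟩)
  simpa [bad] using hcon

/-- For discrete finite `F` the space of all `β` is compact. The `n`-th condition depends only on
entries of index below `n`, so it is closed, and finite families of conditions are satisfiable. -/
theorem exists_forall_noPrimitiveSolution [Fintype F] (t : ℕ) (w : ℕ → ℕ)
    (hsum : ∀ M : ℕ, ∑ n ∈ Finset.range M, (if w n = 0 then (0 : ℝ) else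
      ((w n : ℝ) + 1) ^ t * (Fintype.card F : ℝ) ^ w n / (Fintype.card F : ℝ) ^ n) < 1) :
    ∃ β : Fin (t + 1) → ℕ → F, ∀ n, NoPrimitiveSolution (unitSeries β) (w n) n := by
  let _ : TopologicalSpace F := ⊥
  have : DiscreteTopology F := ⟨rfl⟩
  let G : ℕ → Set (Fin (t + 1) → ℕ → F) := fun n =>
    {β | NoPrimitiveSolution (unitSeries β) (w n) n}
  have hclosed : ∀ n, IsClosed (G n) := by
    intro n
    let r : (Fin (t + 1) → ℕ → F) → (Fin (t + 1) → Fin n → F) := fun β i l => β i l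
    have hr : Continuous r := by fun_prop
    have : G n = r ⁻¹' (r '' G n) := by
      refine (Set.subset_preimage_image r _).antisymm ?_
      rintro β ⟨β', hβ', hββ'⟩ d hd k hk hprim hdvd
      refine hβ' d hd k hk hprim ((X_pow_dvd_linForm_congr fun i l hl => ?_).2 hdvd)
      exact congrFun (congrFun hββ' i) ⟨l, hl⟩
    rw [this]
    exact (isClosed_discrete _).preimage hr
  obtain ⟨β, hβ⟩ := CompactSpace.iInter_nonempty hclosed fun S => by
    obtain ⟨β, hβ⟩ := exists_forall_lt_noPrimitiveSolution (F := F) t w (S.sup id + 1) (hsum _)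
    refine ⟨β, Set.mem_iInter₂.2 fun n hn => hβ n ?_⟩
    exact Nat.lt_succ_of_le (Finset.le_sup (f := id) hn)
  exact ⟨β, fun n => Set.mem_iInter.1 hβ n⟩

/-- Dividing by powers of `x`, one passes from primitive solutions to all nonzero solutions. -/
theorem eq_zero_of_X_pow_dvd_linForm {s : ℕ} (hs : 1 ≤ s) {α : Fin s → PowerSeries F} {T : ℕ → ℕ}
    (hT : Monotone T) (hTle : ∀ m, T m ≤ m)
    (hα : ∀ n, NoPrimitiveSolution α (n + 1 - T (n + 1)) n) {m : ℕ}
    {d : Fin s → ℕ} (hd : ∑ i, d i + T m = m) {k : Fin s → F[X]} (hk : ∀ i, (k i).degree < d i)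
    (h : (PowerSeries.X : PowerSeries F) ^ m ∣ linForm α k) : k = 0 := by
  -- The inequality is needed for the induction: division by `x` may lower `∑ d_i` by more than one.
  suffices H : ∀ m : ℕ, ∀ d : Fin s → ℕ, ∑ i, d i + T m ≤ m → ∀ k : Fin s → F[X],
      (∀ i, (k i).degree < d i) → (PowerSeries.X : PowerSeries F) ^ m ∣ linForm α k → k = 0 from
    H m d hd.le k hk h
  clear! d k m
  intro m
  induction m with
  | zero =>
    intro d hd k hk _
    funext i
    have h0 : d i = 0 := by
      have := Finset.single_le_sum (f := d) (fun _ _ => Nat.zero_le _) (Finset.mem_univ i)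
      omega
    have := hk i
    rwa [h0, Nat.cast_zero, Nat.WithBot.lt_zero_iff, degree_eq_bot] at this
  | succ n ih =>
    intro d hd k hk hdvd
    by_cases hprim : ∃ i, (k i).coeff 0 ≠ 0
    · exfalso
      let i₀ : Fin s := ⟨0, hs⟩
      -- The slack is added to one degree bound to reach the exact sum demanded by
      -- `NoPrimitiveSolution`.
      set c := n + 1 - T (n + 1) - ∑ i, d i with hc
      have hle := hTle (n + 1)
      refine hα n (fun i => d i + if i = i₀ then c else 0) ?_ k (fun i => ?_) hprim hdvd
      · rw [Finset.sum_add_distrib, Finset.sum_ite_eq' Finset.univ i₀, if_pos (Finset.mem_univ _)]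
        omega
      · refine (hk i).trans_le ?_
        exact_mod_cast Nat.le_add_right _ _
    · push Not at hprim
      choose k' hk' using fun i => X_dvd_iff.2 (hprim i)
      have hk'' : k = fun i => X * k' i := funext hk'
      by_cases hzero : k = 0
      · exact hzero
      have hlin : linForm α k = PowerSeries.X * linForm α k' := by
        unfold linForm
        rw [Finset.mul_sum]
        refine Finset.sum_congr rfl fun i _ => ?_
        rw [hk' i, Polynomial.coe_mul, Polynomial.coe_X]
        ring
      rw [hlin, pow_succ', mul_dvd_mul_iff_left PowerSeries.X_ne_zero] at hdvd
      have hdeg : ∀ i, (k' i).degree < (d i - 1 : ℕ) := by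
        intro i
        by_cases h0 : k' i = 0
        · rw [h0, degree_zero]
          exact WithBot.bot_lt_coe _
        · have h1 := hk i
          rw [hk' i, degree_mul, degree_X, degree_eq_natDegree h0] at h1
          rw [degree_eq_natDegree h0]
          have h2 : 1 + (k' i).natDegree < d i := by exact_mod_cast h1
          have h3 : (k' i).natDegree < d i - 1 := by omega
          exact_mod_cast h3
      have hsum : ∑ i, (d i - 1) + 1 ≤ ∑ i, d i := by
        obtain ⟨i, hi⟩ : ∃ i, k i ≠ 0 := by
          by_contra! hcon
          exact hzero (funext hcon)
        have hdi : 0 < d i := by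
          by_contra hcon
          have h1 := hk i
          rw [Nat.eq_zero_of_not_pos hcon, Nat.cast_zero, Nat.WithBot.lt_zero_iff,
            degree_eq_bot] at h1
          exact hi h1
        refine Nat.succ_le_of_lt (Finset.sum_lt_sum (fun j _ => Nat.sub_le _ _)
          ⟨i, Finset.mem_univ i, by omega⟩)
      have hTn := hT (Nat.le_succ n)
      have := ih (fun i => d i - 1) (by simp only [Nat.succ_eq_add_one] at hTn; omega) k' hdeg hdvd
      rw [hk'', this]
      funext i
      simp

end HyperplaneSeq

/-! ### Duality between generating matrices and solutions. -/

namespace HyperplaneSeq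

variable {F : Type*} [Field F] {s : ℕ}

/-- A vector outside `N` is separated from `N` by a functional, which is a dot product. -/
theorem dualSpace_dualSpace {n : Type*} [Fintype n] (N : Submodule F (n → F)) :
    dualSpace (dualSpace N) = N := by
  classical
  refine le_antisymm (fun x hx => ?_) fun x hx A hA => ?_
  · by_contra hxN
    obtain ⟨f, hfx, hfN⟩ := Submodule.exists_le_ker_of_notMem hxN
    have hf : ∀ y, (fun i => f (Pi.single i 1)) ⬝ᵥ y = f y := by
      intro y
      conv_rhs => rw [pi_eq_sum_univ' y]
      simp [dotProduct, mul_comm, map_sum, map_smul]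
    refine hfx ((hf x).symm.trans (hx _ fun B hB => ?_))
    rw [dotProduct_comm, hf]
    exact hfN hB
  · rw [dotProduct_comm]
    exact hA x hx

theorem mem_dualSpace_rowSpace {m n : Type*} [Fintype n] (A : Matrix m n F) (x : n → F) :
    x ∈ dualSpace (rowSpace A) ↔ A.mulVec x = 0 := by
  constructor
  · intro h
    funext r
    exact h _ (Submodule.subset_span ⟨r, rfl⟩)
  · intro h B hB
    induction hB using Submodule.span_induction with
    | mem B hB =>
      obtain ⟨r, rfl⟩ := hB
      exact congrFun h r
    | zero => simp
    | add B B' _ _ hB hB' => rw [add_dotProduct, hB, hB', add_zero]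
    | smul c B _ hB => rw [smul_dotProduct, hB, smul_zero]

theorem mk_rep (m : ℕ) (k : R F m) : AdjoinRoot.mk (X ^ m) (rep m k) = k :=
  AdjoinRoot.mk_leftInverse (monic_X_pow m) k

theorem degree_rep_lt (m : ℕ) (k : R F m) : (rep m k).degree < m := by
  obtain ⟨f, rfl⟩ := AdjoinRoot.mk_surjective k
  rw [rep, AdjoinRoot.modByMonicHom_mk]
  exact (degree_modByMonic_lt _ (monic_X_pow m)).trans_eq (degree_X_pow m)

theorem mem_hyperplane_iff (α : Fin s → PowerSeries F) (m : ℕ) (k : Fin s → R F m) :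
    k ∈ hyperplane α m ↔
      (PowerSeries.X : PowerSeries F) ^ m ∣ linForm α fun i => rep m (k i) := by
  have h1 : k ∈ hyperplane α m ↔ ∑ i, red m (α i) * k i = 0 := Iff.rfl
  have h2 : ∑ i, red m (α i) * k i
      = AdjoinRoot.mk (X ^ m) (∑ i, PowerSeries.trunc m (α i) * rep m (k i)) := by
    rw [map_sum]
    refine Finset.sum_congr rfl fun i _ => ?_
    rw [map_mul, mk_rep, red]
  rw [h1, h2, AdjoinRoot.mk_eq_zero, Polynomial.X_pow_dvd_iff]
  have h3 : (PowerSeries.X : PowerSeries F) ^ m ∣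
      linForm α (fun i => rep m (k i)) -
        ((∑ i, PowerSeries.trunc m (α i) * rep m (k i) : F[X]) : PowerSeries F) := by
    have e : ((∑ i, PowerSeries.trunc m (α i) * rep m (k i) : F[X]) : PowerSeries F)
        = ∑ i, ((PowerSeries.trunc m (α i) : F[X]) : PowerSeries F)
          * (rep m (k i) : PowerSeries F) := by
      rw [← Polynomial.coeToPowerSeries.ringHom_apply, map_sum]
      simp
    rw [e, linForm, ← Finset.sum_sub_distrib]
    refine Finset.dvd_sum fun i _ => ?_
    rw [← sub_mul]
    refine Dvd.dvd.mul_right ?_ _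
    rw [PowerSeries.X_pow_dvd_iff]
    intro r hr
    simp [PowerSeries.coeff_trunc, hr]
  rw [dvd_iff_dvd_of_dvd_sub h3, PowerSeries.X_pow_dvd_iff]
  simp only [Polynomial.coeff_coe]

/-- The representative, independent of `m > j`, of the `j`-th element of the `i`-th basis. -/
noncomputable def BasisSystem.poly (B : BasisSystem F s) (i : Fin s) (j : ℕ) : F[X] :=
  rep (j + 1) (B.basis (j + 1) i (Fin.last j))

theorem BasisSystem.rep_basis (B : BasisSystem F s) (m : ℕ) (i : Fin s) (j : Fin m) :
    rep m (B.basis m i j) = B.poly i j := by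
  induction m with
  | zero => exact j.elim0
  | succ m ih =>
    refine Fin.lastCases ?_ (fun j => ?_) j
    · rfl
    · rw [B.compat, ih]
      rfl

/-- This is what makes arbitrary bases harmless: coordinates supported on the first `d` basis
elements give degree below `d`. -/
theorem BasisSystem.degree_poly_lt (B : BasisSystem F s) (i : Fin s) (j : ℕ) :
    (B.poly i j).degree < (j + 1 : ℕ) :=
  degree_rep_lt _ _

theorem rep_eq_sum (B : BasisSystem F s) (m : ℕ) (k : Fin s → R F m) (i : Fin s) :
    rep m (k i) = ∑ j : Fin m, theta B m k (i, j) • B.poly i j := by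
  conv_lhs => rw [← (B.basis m i).sum_repr (k i)]
  unfold rep
  rw [map_sum]
  refine Finset.sum_congr rfl fun j _ => ?_
  rw [map_smul]
  congr 1
  exact B.rep_basis m i j

theorem theta_surjective (B : BasisSystem F s) (m : ℕ) : Function.Surjective (theta B m) := by
  intro u
  refine ⟨fun i => (B.basis m i).equivFun.symm fun j => u (i, j), ?_⟩
  funext p
  change (B.basis m p.1).equivFun ((B.basis m p.1).equivFun.symm fun j => u (p.1, j)) p.2 = u p
  rw [LinearEquiv.apply_symm_apply]

/-- The generating matrices whose `r`-th columns represent the functionals taking `k` to the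
coefficient of `x ^ r` in `∑ α_i k_i`. -/
noncomputable def coeffMatrix (B : BasisSystem F s) (α : Fin s → PowerSeries F) (i : Fin s) :
    Matrix ℕ ℕ F :=
  fun j r => PowerSeries.coeff r (α i * (B.poly i j : PowerSeries F))

theorem overallMatrix_coeffMatrix_mulVec (B : BasisSystem F s) (α : Fin s → PowerSeries F)
    (m : ℕ) (k : Fin s → R F m) (r : Fin m) :
    (overallMatrix (coeffMatrix B α) m).mulVec (theta B m k) r
      = PowerSeries.coeff r (linForm α fun i => rep m (k i)) := by
  simp only [Matrix.mulVec, dotProduct, overallMatrix, coeffMatrix, linForm, map_sum,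
    Fintype.sum_prod_type]
  refine Finset.sum_congr rfl fun i _ => ?_
  rw [rep_eq_sum B m k i, ← Polynomial.coeToPowerSeries.ringHom_apply, map_sum, Finset.mul_sum,
    map_sum]
  refine Finset.sum_congr rfl fun j _ => ?_
  rw [Polynomial.coeToPowerSeries.ringHom_apply, Polynomial.coe_smul, mul_smul_comm,
    PowerSeries.coeff_smul, smul_eq_mul, mul_comm]

/-- The matrix sends `theta B m k` to the first `m` coefficients of `∑ α_i k_i`, so its kernel is
the chain member; biduality then identifies the row space. -/
theorem generatesHyperplaneSequence_coeffMatrix (B : BasisSystem F s)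
    (α : Fin s → PowerSeries F) : GeneratesHyperplaneSequence B α (coeffMatrix B α) := by
  intro m _
  rw [← dualSpace_dualSpace (rowSpace _)]
  congr 1
  ext u
  obtain ⟨k, rfl⟩ := theta_surjective B m u
  have hmem : k ∈ hyperplane α m ↔
      (overallMatrix (coeffMatrix B α) m).mulVec (theta B m k) = 0 := by
    rw [mem_hyperplane_iff, PowerSeries.X_pow_dvd_iff, funext_iff, Fin.forall_iff]
    refine forall_congr' fun r => forall_congr' fun hr => ?_
    rw [overallMatrix_coeffMatrix_mulVec B α m k ⟨r, hr⟩]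
    rfl
  have hinj : Function.Injective (theta B m) := by
    intro k k' h
    funext i
    refine (AdjoinRoot.mk_leftInverse (monic_X_pow m)).injective ?_
    change rep m (k i) = rep m (k' i)
    rw [rep_eq_sum B, rep_eq_sum B, h]
  rw [mem_dualSpace_rowSpace, ← hmem, chain]
  exact (hinj.mem_set_image (s := (hyperplane α m : Set _))).symm

theorem degree_rep_lt_of_theta (B : BasisSystem F s) {m : ℕ} {k : Fin s → R F m} {i : Fin s}
    {d : ℕ} (h : ∀ j : Fin m, d ≤ j → theta B m k (i, j) = 0) : (rep m (k i)).degree < d := by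
  rw [rep_eq_sum B, ← mem_degreeLT]
  refine Submodule.sum_mem _ fun j _ => ?_
  by_cases hj : d ≤ j
  · rw [h j hj, zero_smul]
    exact Submodule.zero_mem _
  · refine Submodule.smul_mem _ _ (mem_degreeLT.2 ((B.degree_poly_lt i j).trans_le ?_))
    exact_mod_cast Nat.succ_le_of_lt (not_le.1 hj)

/-- A linear relation between the first `d_i` rows of the `C_i^(m)` lies in the chain, hence comes
from a solution `k` with `deg k_i < d_i`. -/
theorem eq_zero_of_overallMatrix_mulVec {B : BasisSystem F s} {α : Fin s → PowerSeries F}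
    {C : Fin s → Matrix ℕ ℕ F} (hC : GeneratesHyperplaneSequence B α C) {m : ℕ}
    {d : Fin s → ℕ}
    (hα : ∀ k : Fin s → F[X], (∀ i, (k i).degree < d i) →
      (PowerSeries.X : PowerSeries F) ^ m ∣ linForm α k → k = 0)
    {u : Fin s × Fin m → F} (hu : ∀ p, d p.1 ≤ p.2 → u p = 0)
    (h : (overallMatrix C m).mulVec u = 0) : u = 0 := by
  rcases Nat.eq_zero_or_pos m with rfl | hm
  · funext p
    exact p.2.elim0
  have hmem : u ∈ chain B α m := by
    rw [← dualSpace_dualSpace (chain B α m), ← hC m hm, mem_dualSpace_rowSpace]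
    exact h
  obtain ⟨k, hk, rfl⟩ := hmem
  have h0 := hα (fun i => rep m (k i)) (fun i => degree_rep_lt_of_theta B fun j hj => hu (i, j) hj)
    ((mem_hyperplane_iff α m k).1 hk)
  have : k = 0 := by
    funext i
    rw [← mk_rep m (k i), congrFun h0 i]
    simp
  rw [this, map_zero]

end HyperplaneSeq

/-! ### From linear independence to nets. -/

namespace HyperplaneSeq

section Digits

variable {b : ℕ}

/-- The integer `b ^ m * trunc m d`. -/
def truncNum (d : ℕ → Fin b) : ℕ → ℕ
  | 0 => 0
  | m + 1 => truncNum d m * b + d m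

theorem trunc_eq (hb : 0 < b) (d : ℕ → Fin b) (m : ℕ) :
    trunc m d = (truncNum d m : ℝ) / (b : ℝ) ^ m := by
  have hb' : (b : ℝ) ≠ 0 := by exact_mod_cast hb.ne'
  induction m with
  | zero => simp [trunc, truncNum]
  | succ m ih =>
    rw [trunc, Finset.sum_range_succ, ← trunc, ih, truncNum]
    push_cast
    field_simp
    ring

theorem truncNum_lt (d : ℕ → Fin b) (m : ℕ) : truncNum d m < b ^ m := by
  induction m with
  | zero => simp [truncNum]
  | succ m ih =>
    rw [truncNum, pow_succ]
    have h1 : truncNum d m + 1 ≤ b ^ m := ih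
    have h2 := (d m).2
    nlinarith

theorem truncNum_add_div (hb : 0 < b) (d : ℕ → Fin b) (D r : ℕ) :
    truncNum d (D + r) / b ^ r = truncNum d D := by
  induction r with
  | zero => simp
  | succ r ih =>
    rw [← add_assoc, truncNum, pow_succ', ← Nat.div_div_eq_div_mul, Nat.mul_comm,
      Nat.mul_add_div hb, Nat.div_eq_of_lt (d (D + r)).2, add_zero, ih]

theorem truncNum_eq_iff (d e : ℕ → Fin b) (D : ℕ) :
    truncNum d D = truncNum e D ↔ ∀ j < D, d j = e j := by
  induction D with
  | zero => simp [truncNum]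
  | succ D ih =>
    rw [Nat.forall_lt_succ_right, ← ih, truncNum, truncNum, Fin.ext_iff]
    have h1 := (d D).2
    have h2 := (e D).2
    refine ⟨fun h => ?_, fun h => by rw [h.1, h.2]⟩
    have hb : 0 < b := by omega
    have h3 := congrArg (· / b) h
    have h4 := congrArg (· % b) h
    simp only [Nat.mul_comm _ b, Nat.mul_add_div hb, Nat.mul_add_mod, Nat.div_eq_of_lt h1,
      Nat.div_eq_of_lt h2, Nat.mod_eq_of_lt h1, Nat.mod_eq_of_lt h2] at h3 h4
    exact ⟨by simpa using h3, h4⟩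

theorem exists_truncNum_eq (hb : 0 < b) (D : ℕ) {a : ℕ} (ha : a < b ^ D) :
    ∃ e : ℕ → Fin b, truncNum e D = a := by
  induction D generalizing a with
  | zero => exact ⟨fun _ => ⟨0, hb⟩, by simp [truncNum] at ha ⊢; exact ha.symm⟩
  | succ D ih =>
    obtain ⟨e, he⟩ := ih (a := a / b) (Nat.div_lt_of_lt_mul (by rwa [← pow_succ']))
    refine ⟨fun j => if j < D then e j else ⟨a % b, Nat.mod_lt _ hb⟩, ?_⟩
    rw [truncNum, (truncNum_eq_iff _ e D).2 (fun j hj => by simp [hj]), he]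
    simp [Nat.div_add_mod']

/-- Dropping the last `m - D` digits is integer division of `truncNum d m` by `b ^ (m - D)`. -/
theorem trunc_mem_Ico_iff (hb : 0 < b) (d e : ℕ → Fin b) {D m : ℕ} (hD : D ≤ m) :
    trunc m d ∈ Set.Ico ((truncNum e D : ℝ) / (b : ℝ) ^ D)
      (((truncNum e D : ℝ) + 1) / (b : ℝ) ^ D) ↔ ∀ j < D, d j = e j := by
  obtain ⟨r, rfl⟩ := Nat.exists_eq_add_of_le hD
  have hb' : (0 : ℝ) < b := by exact_mod_cast hb
  rw [← truncNum_eq_iff, ← truncNum_add_div hb d D r, trunc_eq hb, Set.mem_Ico,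
    div_le_div_iff₀ (by positivity) (by positivity), div_lt_div_iff₀ (by positivity) (by positivity),
    pow_add, ← mul_assoc, mul_right_comm, mul_le_mul_iff_left₀ (by positivity), ← mul_assoc,
    mul_right_comm _ ((b : ℝ) ^ D), mul_lt_mul_iff_left₀ (by positivity), Nat.div_eq_iff (by positivity)]
  norm_cast
  have : 0 < b ^ r := by positivity
  rw [add_mul, one_mul]
  omega

theorem trunc_mem_Ico_zero_one (hb : 0 < b) (d : ℕ → Fin b) (m : ℕ) :
    trunc m d ∈ Set.Ico (0 : ℝ) 1 := by
  have hb' : (0 : ℝ) < b := by exact_mod_cast hb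
  rw [trunc_eq hb, Set.mem_Ico, div_lt_one (by positivity)]
  exact ⟨by positivity, by exact_mod_cast truncNum_lt d m⟩

theorem hasSum_ofDigits (d : ℕ → Fin b) :
    HasSum (fun j => ((d j : ℕ) : ℝ) / (b : ℝ) ^ (j + 1)) (Real.ofDigits d) := by
  simp only [div_eq_mul_inv]
  exact (Real.summable_ofDigitsTerm (digits := d)).hasSum

end Digits

variable {F : Type*} [Field F] {s q : ℕ}

theorem digitalPoint_eq_ofDigits (φ : Fin q ≃ F) (C : Fin s → Matrix ℕ ℕ F) (k : ℕ) (i : Fin s) :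
    digitalPoint φ C k i = Real.ofDigits (digitalDigit φ C k i) :=
  (hasSum_ofDigits _).tsum_eq

/-- Only finitely many columns contribute, so the expansion is finite and cannot end in digits `q -
1`. -/
theorem digitalPoint_lt_one {φ : Fin q ≃ F} (hφ : ((φ.symm 0 : Fin q) : ℕ) = 0)
    {C : Fin s → Matrix ℕ ℕ F} (hC : ∀ (i : Fin s) (c : ℕ), {j : ℕ | C i j c ≠ 0}.Finite)
    (k : ℕ) (i : Fin s) : digitalPoint φ C k i < 1 := by
  set S : Set ℕ := ⋃ c ∈ Finset.range (Nat.digits q k).length, {j : ℕ | C i j c ≠ 0} with hS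
  have hSfin : S.Finite := Set.Finite.biUnion (Finset.finite_toSet _) fun c _ => hC i c
  obtain ⟨M, hM⟩ := hSfin.bddAbove
  have hzero : ∀ j, M < j → ((digitalDigit φ C k i j : Fin q) : ℕ) = 0 := by
    intro j hj
    rw [digitalDigit, Finset.sum_eq_zero, hφ]
    intro c hc
    by_contra hne
    have : j ∈ S := Set.mem_biUnion (Finset.mem_coe.2 hc) (left_ne_zero_of_mul hne)
    exact absurd (hM this) (not_le.2 hj)
  have : digitalPoint φ C k i = trunc (M + 1) (digitalDigit φ C k i) := by
    refine tsum_eq_sum fun j hj => ?_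
    rw [hzero j (by simpa using hj)]
    simp
  rw [this]
  exact (trunc_mem_Ico_zero_one (Fin.pos (φ.symm 0)) _ _).2

theorem digitalDigit_eq (hq : 2 ≤ q) {φ : Fin q ≃ F} (hφ : ((φ.symm 0 : Fin q) : ℕ) = 0)
    (C : Fin s → Matrix ℕ ℕ F) {k M : ℕ} (hk : k < q ^ M) (i : Fin s) (j : ℕ) :
    digitalDigit φ C k i j
      = φ.symm (∑ c ∈ Finset.range M, C i j c * φ (natDigit φ k c)) := by
  rw [digitalDigit]
  congr 1
  refine Finset.sum_subset (Finset.range_mono ((Nat.digits_length_le_iff hq k).2 hk)) ?_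
  intro c _ hc
  have hlt : k < q ^ c := (Nat.digits_length_le_iff hq k).1 (by simpa using hc)
  have : natDigit φ k c = φ.symm 0 := by
    refine Fin.ext ?_
    rw [hφ]
    simp [natDigit, Nat.div_eq_of_lt hlt]
  rw [this, Equiv.apply_symm_apply, mul_zero]

/-- The vector of the images of the base `q` digits of `n < q ^ m`. -/
def digitVector (φ : Fin q ≃ F) (m : ℕ) : Fin (q ^ m) ≃ (Fin m → F) :=
  finFunctionFinEquiv.symm.trans (Equiv.arrowCongr (Equiv.refl _) φ)

/-- Within a block the low `m` digits run through `F ^ m`, while the digits of `k` add a constant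
shift. The range `k` suffices as `k < q ^ k`. -/
theorem digitalDigit_block (hq : 2 ≤ q) {φ : Fin q ≃ F} (hφ : ((φ.symm 0 : Fin q) : ℕ) = 0)
    (C : Fin s → Matrix ℕ ℕ F) (m k : ℕ) (n : Fin (q ^ m)) (i : Fin s) (j : ℕ) :
    digitalDigit φ C (k * q ^ m + n) i j = φ.symm (∑ c : Fin m, C i j c * digitVector φ m n c
      + ∑ c ∈ Finset.range k, C i j (m + c) * φ (natDigit φ k c)) := by
  have hk : k < q ^ k := Nat.lt_pow_self hq
  have hlt : k * q ^ m + n < q ^ (m + k) := by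
    have h1 := n.2
    rw [pow_add]
    nlinarith
  have hpos : 0 < q ^ m := by positivity
  have hdiv : (k * q ^ m + n) / q ^ m = k := by
    rw [Nat.mul_comm, Nat.mul_add_div hpos, Nat.div_eq_of_lt n.2, add_zero]
  rw [digitalDigit_eq hq hφ C hlt, Finset.sum_range_add, Finset.sum_range]
  congr 2
  · refine Finset.sum_congr rfl fun c _ => ?_
    congr 1
    change φ _ = φ _
    congr 1
    refine Fin.ext ?_
    change (k * q ^ m + n) / q ^ (c : ℕ) % q = (n : ℕ) / q ^ (c : ℕ) % q
    obtain ⟨r, hr⟩ := Nat.exists_eq_add_of_lt c.2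
    have e : k * q ^ m + n = q ^ (c : ℕ) * (q * (q ^ r * k)) + n := by
      have : q ^ m = q ^ ((c : ℕ) + r + 1) := congrArg (q ^ ·) hr
      linear_combination k * this
    rw [e, Nat.mul_add_div (by positivity), Nat.mul_add_mod]
  · refine Finset.sum_congr rfl fun c _ => ?_
    congr 2
    refine Fin.ext ?_
    change (k * q ^ m + n) / q ^ (m + c) % q = k / q ^ c % q
    rw [pow_add, ← Nat.div_div_eq_div_mul, hdiv]

/-- The fibres of a surjective matrix. -/
theorem ncard_vecMul_eq [Finite F] {m : ℕ} {S : Type*} [Fintype S]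
    (A : Matrix (Fin m) S F) (hA : ∀ u, A.mulVec u = 0 → u = 0) (y : S → F) {t : ℕ}
    (ht : Fintype.card S + t = m) :
    {v : Fin m → F | Matrix.vecMul v A = y}.ncard = Nat.card F ^ t := by
  -- Independent columns leave the row space with zero dual, so `v ↦ v A` is onto and its fibres are
  -- cosets of a kernel of dimension `t`.
  have htop : rowSpace A = ⊤ := by
    rw [← dualSpace_dualSpace (rowSpace A), eq_top_iff]
    intro x _ u hu
    rw [hA u ((mem_dualSpace_rowSpace A u).1 hu), zero_dotProduct]
  have hrange : LinearMap.range A.vecMulLinear = ⊤ := by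
    rw [range_vecMulLinear]
    exact htop
  obtain ⟨v₀, hv₀⟩ := LinearMap.range_eq_top.1 hrange y
  have hset : {v : Fin m → F | Matrix.vecMul v A = y}
      = (fun v => v + v₀) '' (LinearMap.ker A.vecMulLinear : Set (Fin m → F)) := by
    ext v
    simp only [Set.mem_image, SetLike.mem_coe, LinearMap.mem_ker]
    constructor
    · intro hv
      refine ⟨v - v₀, ?_, sub_add_cancel _ _⟩
      rw [map_sub, hv₀, sub_eq_zero]
      exact hv
    · rintro ⟨v', hv', rfl⟩
      change A.vecMulLinear (v' + v₀) = y
      rw [map_add, hv', hv₀, zero_add]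
  have hfin := LinearMap.finrank_range_add_finrank_ker A.vecMulLinear
  rw [hrange, finrank_top, Module.finrank_fintype_fun_eq_card, Module.finrank_fintype_fun_eq_card,
    Fintype.card_fin] at hfin
  rw [hset, Set.ncard_image_of_injective _ (add_left_injective v₀), ← Nat.card_coe_set_eq]
  change Nat.card (LinearMap.ker A.vecMulLinear) = _
  rw [Module.natCard_eq_pow_finrank (K := F)]
  congr 1
  omega

theorem mulVec_submatrix_subtype {m : ℕ} {n : Type*} [Fintype n] (P : n → Prop) [DecidablePred P]
    (A : Matrix (Fin m) n F) (u : {p // P p} → F) :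
    A.mulVec (fun p => if h : P p then u ⟨p, h⟩ else 0)
      = (A.submatrix id (Subtype.val : {p // P p} → n)).mulVec u := by
  funext r
  refine (Fintype.sum_of_injective Subtype.val Subtype.val_injective _ _ ?_ ?_).symm
  · intro p hp
    have : ¬ P p := fun h => hp ⟨⟨p, h⟩, rfl⟩
    simp [this]
  · intro p
    simp [p.2]

/-- Lying in an elementary interval amounts to `m - T m` independent affine equations in the `m` low
digits, with `q ^ T m` solutions. -/
theorem isDigitalTSSequence_of_mulVec [Finite F] (hq : 2 ≤ q) {φ : Fin q ≃ F}
    (hφ : ((φ.symm 0 : Fin q) : ℕ) = 0) {C : Fin s → Matrix ℕ ℕ F} {T : ℕ → ℕ}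
    (hT : ∀ m, T m ≤ m)
    (hC : ∀ m, ∀ d : Fin s → ℕ, ∑ i, d i + T m = m → ∀ u : Fin s × Fin m → F,
      (∀ p, d p.1 ≤ p.2 → u p = 0) → (overallMatrix C m).mulVec u = 0 → u = 0) :
    IsDigitalTSSequence φ C T := by
  have hb : 0 < q := by omega
  have hcard : Nat.card F = q := by rw [← Nat.card_congr φ, Nat.card_fin]
  refine ⟨fun k i => ?_, fun k i => ?_, hT, fun m k => ⟨hT m, fun n i =>
    trunc_mem_Ico_zero_one hb _ _, fun d a ha hd => ?_⟩⟩
  · rw [digitalPoint_eq_ofDigits]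
    exact ⟨Real.ofDigits_nonneg _, Real.ofDigits_le_one _⟩
  · rw [digitalPoint_eq_ofDigits]
    exact hasSum_ofDigits _
  have hdm : ∀ i, d i ≤ m := fun i => by
    have := Finset.single_le_sum (f := d) (fun _ _ => Nat.zero_le _) (Finset.mem_univ i)
    omega
  choose e he using fun i => exists_truncNum_eq hb (d i) (ha i)
  let P : Fin s × Fin m → Prop := fun p => (p.2 : ℕ) < d p.1
  let A : Matrix (Fin m) {p // P p} F := (overallMatrix C m).submatrix id Subtype.val
  -- The prescribed digits, corrected by the constant shift of the block.
  let y : {p // P p} → F := fun p => φ (e p.1.1 p.1.2)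
    - ∑ c ∈ Finset.range k, C p.1.1 p.1.2 (m + c) * φ (natDigit φ k c)
  have hA : ∀ u, A.mulVec u = 0 → u = 0 := by
    intro u hu
    have h0 := hC m d hd (fun p => if h : P p then u ⟨p, h⟩ else 0)
      (fun p hp => dif_neg (not_lt.2 hp)) ((mulVec_submatrix_subtype P _ u).trans hu)
    funext p
    simpa [p.2] using congrFun h0 p.1
  have hcardS : Fintype.card {p // P p} = ∑ i, d i := by
    let E : {p // P p} ≃ Σ i : Fin s, Fin (d i) :=
      { toFun := fun p => ⟨p.1.1, ⟨p.1.2, p.2⟩⟩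
        invFun := fun x => ⟨(x.1, ⟨x.2, x.2.2.trans_le (hdm x.1)⟩), x.2.2⟩
        left_inv := fun p => rfl
        right_inv := fun x => rfl }
    rw [Fintype.card_congr E, Fintype.card_sigma]
    simp
  have hcount := ncard_vecMul_eq A hA y (t := T m) (by rw [hcardS, hd])
  rw [hcard] at hcount
  rw [← hcount, ← Set.ncard_image_of_injective _ (digitVector φ m).injective]
  congr 1
  rw [Equiv.image_eq_preimage_symm]
  ext v
  obtain ⟨n, rfl⟩ := (digitVector φ m).surjective v
  simp only [Set.mem_preimage, Equiv.symm_apply_apply, Set.mem_ofPred_eq]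
  have hiff : ∀ i, trunc m (digitalDigit φ C (k * q ^ m + n) i) ∈
      Set.Ico ((a i : ℝ) / (q : ℝ) ^ d i) (((a i : ℝ) + 1) / (q : ℝ) ^ d i) ↔
      ∀ j < d i, digitalDigit φ C (k * q ^ m + n) i j = e i j := fun i => by
    rw [← he i]
    exact trunc_mem_Ico_iff hb _ _ (hdm i)
  simp only [hiff, digitalDigit_block hq hφ, Equiv.symm_apply_eq]
  rw [funext_iff]
  have hval : ∀ p : {p // P p}, Matrix.vecMul (digitVector φ m n) A p
      = ∑ c : Fin m, C p.1.1 p.1.2 c * digitVector φ m n c := fun p => by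
    simp only [Matrix.vecMul, dotProduct]
    exact Finset.sum_congr rfl fun c _ => mul_comm (digitVector φ m n c) (C p.1.1 p.1.2 c)
  simp only [hval, y, eq_sub_iff_add_eq]
  constructor
  · intro h p
    exact h p.1.1 p.1.2 p.2
  · intro h i j hj
    exact h ⟨(i, ⟨j, hj.trans_le (hdm i)⟩), hj⟩

end HyperplaneSeq

/-! ### Assembly. -/

theorem mainTheorem6 (s q : ℕ) (hs : 1 ≤ s) (hq : IsPrimePow q) :
    ∃ L : ℤ, ∀ (F : Type*) [Field F], Nat.card F = q →
      ∃ α ∈ HyperplaneSeq.YTilde F s,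
        ∀ (φ : Fin q ≃ F), ((φ.symm 0 : Fin q) : ℕ) = 0 →
        ∀ B : HyperplaneSeq.BasisSystem F s,
          (∃ C : Fin s → Matrix ℕ ℕ F, HyperplaneSeq.GeneratesHyperplaneSequence B α C) ∧
          ∀ C : Fin s → Matrix ℕ ℕ F, HyperplaneSeq.GeneratesHyperplaneSequence B α C →
            (∃ T : ℕ → ℕ, HyperplaneSeq.IsDigitalTSSequence φ C T ∧
              ∀ m : ℕ, 2 ≤ m →
                (T m : ℝ) ≤ s * Real.logb q m + 2 * Real.logb q (Real.log m) + L) ∧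
            ((∀ (i : Fin s) (c : ℕ), {j : ℕ | C i j c ≠ 0}.Finite) →
              ∀ (k : ℕ) (i : Fin s),
                HyperplaneSeq.digitalPoint φ C k i ∈ Set.Ico (0 : ℝ) 1) := by
  have hq2 : 2 ≤ q := hq.two_le
  obtain ⟨t, rfl⟩ := Nat.exists_eq_add_of_le' hs
  obtain ⟨A, hA, hsum⟩ := HyperplaneSeq.exists_sum_weight_lt_one t hq2
  obtain ⟨L, hL⟩ := HyperplaneSeq.exists_quality_le (s := t + 1) hq2 hA
  -- `A` and `L` were obtained from `t` and `q` alone, so they serve every field of order `q`.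
  refine ⟨L, fun F _ hF => ?_⟩
  have : Finite F := Nat.finite_of_card_ne_zero (by omega)
  have : Fintype F := Fintype.ofFinite F
  obtain ⟨β, hβ⟩ := HyperplaneSeq.exists_forall_noPrimitiveSolution (F := F) t
    (fun n => n + 1 - HyperplaneSeq.quality (t + 1) q A (n + 1)) (by
      rw [← Nat.card_eq_fintype_card, hF]
      exact hsum)
  refine ⟨HyperplaneSeq.unitSeries β, HyperplaneSeq.unitSeries_mem_YTilde β,
    fun φ hφ B => ⟨⟨_, HyperplaneSeq.generatesHyperplaneSequence_coeffMatrix B _⟩,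
      fun C hC => ⟨⟨HyperplaneSeq.quality (t + 1) q A, ?_, hL⟩, fun hfin k i =>
        ⟨?_, HyperplaneSeq.digitalPoint_lt_one hφ hfin k i⟩⟩⟩⟩
  · refine HyperplaneSeq.isDigitalTSSequence_of_mulVec hq2 hφ
      (HyperplaneSeq.quality_le _ _ _) fun m d hd u hu h => ?_
    exact HyperplaneSeq.eq_zero_of_overallMatrix_mulVec hC
      (fun k hk hdvd => HyperplaneSeq.eq_zero_of_X_pow_dvd_linForm hs
        (HyperplaneSeq.quality_mono _ _ hA.le) (HyperplaneSeq.quality_le _ _ _) hβ hd hk hdvd)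
      hu h
  · rw [HyperplaneSeq.digitalPoint_eq_ofDigits]
    exact Real.ofDigits_nonneg _
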